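/- Let $\mu$ be the counting measure on all subsets of $\mathbb Z_+=\{0,1,2,\dots\}$, and let $\phi\colon\mathbb Z_+\to\mathbb Z_+$ be given by $\phi(0)=0$ and $\phi(n)=n-1$ for $n\ge 1$. For $w\colon\mathbb Z_+\to\mathbb C$, let $C_{\phi,w}$ be the weighted composition operator in the complex Hilbert space $L^2(\mu)=\ell^2(\mathbb Z_+)$ with domain $\{f\in L^2(\mu): w\cdot(f\circ\phi)\in L^2(\mu)\}$, given by $C_{\phi,w}f=w\cdot(f\circ\phi)$. For a left-invertible bounded operator $T$ on a Hilbert space, $T'=T(T^*T)^{-1}$ denotes its Cauchy dual; $T$ is a $2$-isometry if $I-2T^*T+T^{*2}T^2=0$; and $T$ is subnormal if it is the restriction of a bounded normal operator on a complex Hilbert space containing (isometrically) the given one. Suppose that $|w(0)|=1$ and $|w(n)|=1$ for every integer $n\ge 2$. Then $C_{\phi,w}$ is an everywhere defined bounded operator on $L^2(\mu)$, it is a $2$-isometry (and left-invertible, so that its Cauchy dual $C_{\phi,w}'$ is defined), and $C_{\phi,w}'$ is subnormal. Moreover, $C_{\phi,w}'$ is an isometry if and only if $C_{\phi,w}$ is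 an isometry, and this holds if and only if $w(1)=0$. -/

import Mathlib

open MeasureTheory
open scoped ENNReal

namespace CauchyDual

universe u

/-! ### Operator-theoretic notions on a complex Hilbert space -/

section Operators

variable {H : Type u} [NormedAddCommGroup H] [InnerProductSpace ℂ H] [CompleteSpace H]

/-- `T` is a `2`-isometry: `I - 2 T* T + T*² T² = 0`. -/
def IsTwoIsometry (T : H →L[ℂ] H) : Prop :=
  1 - (2 : ℂ) • (ContinuousLinearMap.adjoint T * T)
    + (ContinuousLinearMap.adjoint T) ^ 2 * T ^ 2 = 0

/-- `T` has a bounded left inverse. -/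
def IsLeftInvertible (T : H →L[ℂ] H) : Prop :=
  ∃ S : H →L[ℂ] H, S * T = 1

/-- The Cauchy dual `T' = T (T* T)⁻¹`. It is meaningful for left-invertible `T`, for which `T* T`
is an invertible element of the algebra of bounded operators (`Ring.inverse` is the inverse of an
invertible element). -/
noncomputable def cauchyDual (T : H →L[ℂ] H) : H →L[ℂ] H :=
  T * Ring.inverse (ContinuousLinearMap.adjoint T * T)

/-- `T` is subnormal: it is the restriction of a bounded normal operator `N` on a complex Hilbert
space `K` in which `H` is isometrically embedded. -/
def IsSubnormal (T : H →L[ℂ] H) : Prop :=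
  ∃ (K : Type u) (_ : NormedAddCommGroup K) (_ : InnerProductSpace ℂ K) (_ : CompleteSpace K)
    (J : H →ₗᵢ[ℂ] K) (N : K →L[ℂ] K), IsStarNormal N ∧ ∀ h : H, J (T h) = N (J h)

end Operators

/-! ### Weighted composition operators in `L²(μ)` -/

section WeightedComposition

variable {X : Type*} [MeasurableSpace X]

/-- The well-definedness condition `μ_w ∘ φ⁻¹ ≪ μ`, where `dμ_w = |w|² dμ`. -/
def Admissible (μ : Measure X) (φ : X → X) (w : X → ℂ) : Prop :=
  Measurable φ ∧ Measurable w ∧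
    (μ.withDensity fun x => ‖w x‖ₑ ^ 2).map φ ≪ μ

theorem Admissible.ae_eq {μ : Measure X} {φ : X → X} {w : X → ℂ} (h : Admissible μ φ w)
    {f g : X → ℂ} (hfg : f =ᵐ[μ] g) :
    (fun x => w x * f (φ x)) =ᵐ[μ] fun x => w x * g (φ x) := by
  obtain ⟨hφ, hw, hac⟩ := h
  have h1 : ∀ᵐ x ∂(μ.withDensity fun x => ‖w x‖ₑ ^ 2), f (φ x) = g (φ x) :=
    ae_of_ae_map hφ.aemeasurable (hac.ae_le hfg)
  rw [ae_withDensity_iff (by fun_prop)] at h1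
  filter_upwards [h1] with x hx
  by_cases h0 : w x = 0
  · simp [h0]
  · rw [hx (by simpa using h0)]

/-- The weighted composition operator `C_{φ,w}` in `L²(μ)`, in general unbounded: its domain is
`{f ∈ L²(μ) : w · (f ∘ φ) ∈ L²(μ)}`, and it acts by `f ↦ w · (f ∘ φ)`. -/
noncomputable def weightedComposition (μ : Measure X) (φ : X → X) (w : X → ℂ)
    (h : Admissible μ φ w) : Lp ℂ 2 μ →ₗ.[ℂ] Lp ℂ 2 μ where
  domain :=
    { carrier := {f | MemLp (fun x => w x * f (φ x)) 2 μ}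
      add_mem' := by
        intro f g hf hg
        refine (MemLp.add hf hg).ae_eq ?_
        refine Filter.EventuallyEq.trans ?_ (h.ae_eq (Lp.coeFn_add f g)).symm
        exact Filter.Eventually.of_forall fun x => by simp [mul_add]
      zero_mem' := by
        refine (MemLp.zero (ε := ℂ)).ae_eq ?_
        refine Filter.EventuallyEq.trans ?_ (h.ae_eq (Lp.coeFn_zero ℂ 2 μ)).symm
        exact Filter.Eventually.of_forall fun x => by simp
      smul_mem' := by
        intro c f hf
        refine (MemLp.const_smul hf c).ae_eq ?_
        refine Filter.EventuallyEq.trans ?_ (h.ae_eq (Lp.coeFn_smul c f)).symm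
        exact Filter.Eventually.of_forall fun x => by simp [mul_left_comm] }
  toFun :=
    { toFun := fun f => MemLp.toLp (fun x => w x * f.1 (φ x)) f.2
      map_add' := by
        rintro ⟨f, hf⟩ ⟨g, hg⟩
        rw [← MemLp.toLp_add, MemLp.toLp_eq_toLp_iff]
        refine (h.ae_eq (Lp.coeFn_add f g)).trans ?_
        exact Filter.Eventually.of_forall fun x => by simp [mul_add]
      map_smul' := by
        rintro c ⟨f, hf⟩
        rw [RingHom.id_apply, ← MemLp.toLp_const_smul, MemLp.toLp_eq_toLp_iff]
        refine (h.ae_eq (Lp.coeFn_smul c f)).trans ?_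
        exact Filter.Eventually.of_forall fun x => by simp [mul_left_comm] }

end WeightedComposition

/-! ### The family on `ℓ²(ℤ₊)` -/

/-- The map `φ : ℤ₊ → ℤ₊` with `φ 0 = 0` and `φ n = n - 1` for `n ≥ 1`. -/
def phi : ℕ → ℕ
  | 0 => 0
  | n + 1 => n

theorem admissible_phi (w : ℕ → ℂ) : Admissible Measure.count phi w := by
  refine ⟨measurable_from_top, measurable_from_top, fun s hs => ?_⟩
  have : s = ∅ := Measure.count_eq_zero_iff.mp hs
  simp [this]

/-- The Hilbert space `L²(μ)` of the counting measure `μ` on all subsets of `ℤ₊`. -/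
abbrev L2Nat : Type := Lp ℂ 2 (Measure.count : Measure ℕ)

/-- The operator `C_{φ,w}` in `L²` of the counting measure on `ℤ₊`, for the above `φ`. -/
noncomputable def C (w : ℕ → ℂ) : L2Nat →ₗ.[ℂ] L2Nat :=
  weightedComposition Measure.count phi w (admissible_phi w)

end CauchyDual

/-! Let `P` be the projection onto `e₀` and `S` an isometric weighted shift with `S* e₀ = 0`. Then
`C_{φ,w} = S(1 - P + qP) + pP` with `p = w 0`, `q = w 1`, and everything is algebra from `S*S = 1`,
`S*P = 0`. Since `T*T = 1 - P + (|p|² + |q|²)P`, the Cauchy dual has the same shape, with `p`, `q`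
multiplied by `s = 1/(1 + |q|²)`; the isometry criteria can be read off (`cauchyDual_perturb`,
`isometry_perturb_iff`). Subnormality of the dual, with coefficients `α`, `β`, comes from an
explicit normal extension: the Halmos unitary dilation of `S` plus the scalar `α` on `ℂ`. The
embedding is `f ↦ (Af, Yf, lf)`, with `A = 1 - P + βP`, `Y = αβ(1 - αS)⁻¹P` and `l` a multiple of
`⟨e₀, ·⟩`. It can be made isometric because `|α|² + |β|² = s ≤ 1`
(`isSubnormal_perturb_of_operator`). -/

namespace CauchyDual

universe u

/-! ### Two-by-two operator matrices. -/

section Block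

variable {E : Type*} {F : Type*} [NormedAddCommGroup E] [InnerProductSpace ℂ E]
  [NormedAddCommGroup F] [InnerProductSpace ℂ F]

/-- The operator with the block matrix `[[a, b], [c, d]]` on the Hilbert sum `E ⊕ F`. -/
noncomputable def blockOperator (a : E →L[ℂ] E) (b : F →L[ℂ] E) (c : E →L[ℂ] F) (d : F →L[ℂ] F) :
    WithLp 2 (E × F) →L[ℂ] WithLp 2 (E × F) :=
  (WithLp.prodContinuousLinearEquiv 2 ℂ E F).symm.toContinuousLinearMap ∘L
    ((a.coprod b).prod (c.coprod d)) ∘L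
      (WithLp.prodContinuousLinearEquiv 2 ℂ E F).toContinuousLinearMap

theorem blockOperator_apply (a : E →L[ℂ] E) (b : F →L[ℂ] E) (c : E →L[ℂ] F) (d : F →L[ℂ] F)
    (x : WithLp 2 (E × F)) :
    blockOperator a b c d x = WithLp.toLp 2 (a x.fst + b x.snd, c x.fst + d x.snd) := rfl

theorem blockOperator_mul (a a' : E →L[ℂ] E) (b b' : F →L[ℂ] E) (c c' : E →L[ℂ] F)
    (d d' : F →L[ℂ] F) :
    blockOperator a b c d * blockOperator a' b' c' d' =
      blockOperator (a ∘L a' + b ∘L c') (a ∘L b' + b ∘L d') (c ∘L a' + d ∘L c')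
        (c ∘L b' + d ∘L d') := by
  refine ContinuousLinearMap.ext fun x => ?_
  change blockOperator a b c d (blockOperator a' b' c' d' x) = _
  simp only [blockOperator_apply, add_apply, ContinuousLinearMap.comp_apply, map_add,
    WithLp.toLp_fst, WithLp.toLp_snd]
  congr 2 <;> abel

variable [CompleteSpace E] [CompleteSpace F]

theorem star_blockOperator (a : E →L[ℂ] E) (b : F →L[ℂ] E) (c : E →L[ℂ] F) (d : F →L[ℂ] F) :
    star (blockOperator a b c d) =
      blockOperator (ContinuousLinearMap.adjoint a) (ContinuousLinearMap.adjoint c)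
        (ContinuousLinearMap.adjoint b) (ContinuousLinearMap.adjoint d) := by
  rw [ContinuousLinearMap.star_eq_adjoint, eq_comm, ContinuousLinearMap.eq_adjoint_iff]
  intro x y
  simp only [blockOperator_apply, WithLp.prod_inner_apply, inner_add_left, inner_add_right,
    ContinuousLinearMap.adjoint_inner_left]
  exact add_add_add_comm _ _ _ _

end Block

/-! ### Normal extensions built from the Halmos dilation. -/

section Subnormal

variable {H : Type u} [NormedAddCommGroup H] [InnerProductSpace ℂ H] [CompleteSpace H]

/-- The Halmos dilation of an isometry is unitary, in particular normal. -/
theorem isStarNormal_halmosDilation (S : H →L[ℂ] H) (hS : star S * S = 1) :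
    IsStarNormal (blockOperator S (1 - S * star S) 0 (star S)) := by
  have hS' (x : H →L[ℂ] H) : star S * (S * x) = x := by rw [← mul_assoc, hS, one_mul]
  refine ⟨?_⟩
  rw [commute_iff_eq, star_blockOperator]
  simp only [← ContinuousLinearMap.star_eq_adjoint, blockOperator_mul,
    ← ContinuousLinearMap.mul_def, star_sub, star_mul, star_star, star_one, hS,
    mul_sub, sub_mul, mul_one, one_mul, zero_mul, mul_zero, mul_assoc, hS', sub_self, add_zero,
    zero_add, sub_zero, map_zero]
  congr 1 <;> abel

theorem isStarNormal_blockDiagonal {E F : Type*} [NormedAddCommGroup E] [InnerProductSpace ℂ E]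
    [NormedAddCommGroup F] [InnerProductSpace ℂ F] [CompleteSpace E] [CompleteSpace F]
    {a : E →L[ℂ] E} {d : F →L[ℂ] F} (ha : IsStarNormal a) (hd : IsStarNormal d) :
    IsStarNormal (blockOperator a 0 0 d) := by
  refine ⟨?_⟩
  rw [commute_iff_eq, star_blockOperator]
  simp only [blockOperator_mul, map_zero, ContinuousLinearMap.comp_zero,
    ContinuousLinearMap.zero_comp, add_zero, zero_add]
  congr 1
  · exact ha.star_comm_self.eq
  · exact hd.star_comm_self.eq

/-- The embedding `f ↦ (A f, Y f, l f)` of `H` into `H ⊕ H ⊕ ℂ`. -/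
noncomputable def tripleEmbedding (A Y : H →L[ℂ] H) (l : H →L[ℂ] ℂ) :
    H →ₗ[ℂ] WithLp 2 (WithLp 2 (H × H) × ℂ) where
  toFun f := WithLp.toLp 2 (WithLp.toLp 2 (A f, Y f), l f)
  map_add' f g := by simp [← WithLp.toLp_add]
  map_smul' c f := by simp [← WithLp.toLp_smul]

omit [CompleteSpace H] in
theorem tripleEmbedding_apply (A Y : H →L[ℂ] H) (l : H →L[ℂ] ℂ) (f : H) :
    tripleEmbedding A Y l f = WithLp.toLp 2 (WithLp.toLp 2 (A f, Y f), l f) := rfl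

/-- The normal operator is the Halmos dilation of `S` plus multiplication by `α`; the hypotheses are
its intertwining relation with `T`, row by row, and the isometry of the embedding. -/
theorem IsSubnormal.of_intertwining {T S A Y : H →L[ℂ] H} {l : H →L[ℂ] ℂ} {α : ℂ}
    (hS : star S * S = 1) (hA : S * A + (1 - S * star S) * Y = A * T) (hY : star S * Y = Y * T)
    (hl : ∀ f, l (T f) = α * l f) (hnorm : ∀ f, ‖A f‖ ^ 2 + ‖Y f‖ ^ 2 + ‖l f‖ ^ 2 = ‖f‖ ^ 2) :
    IsSubnormal T := by
  refine ⟨WithLp 2 (WithLp 2 (H × H) × ℂ), inferInstance, inferInstance, inferInstance,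
    ⟨tripleEmbedding A Y l, fun f => ?_⟩,
    blockOperator (blockOperator S (1 - S * star S) 0 (star S)) 0 0 (α • 1),
    isStarNormal_blockDiagonal (isStarNormal_halmosDilation S hS) ⟨?_⟩, fun f => ?_⟩
  · rw [← sq_eq_sq₀ (norm_nonneg _) (norm_nonneg _), ← hnorm f]
    simp [tripleEmbedding_apply, WithLp.prod_norm_sq_eq_of_L2]
  · simp [commute_iff_eq, smul_smul, mul_comm]
  · have h1 : S (A f) + (1 - S * star S) (Y f) = A (T f) :=
      congrArg (fun B : H →L[ℂ] H => B f) hA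
    have h2 : star S (Y f) = Y (T f) := congrArg (fun B : H →L[ℂ] H => B f) hY
    change tripleEmbedding A Y l (T f) = blockOperator _ _ _ _ (tripleEmbedding A Y l f)
    simp only [tripleEmbedding_apply, blockOperator_apply, ← h1, ← h2, hl, zero_apply, add_zero,
      zero_add, smul_apply, one_apply_eq_self, smul_eq_mul,
      WithLp.toLp_fst, WithLp.toLp_snd]

end Subnormal

/-! ### Algebra of the perturbed isometry and its Cauchy dual. -/

section RankOnePerturbation

open InnerProductSpace ComplexConjugate

variable {H : Type u} [NormedAddCommGroup H] [InnerProductSpace ℂ H] [CompleteSpace H]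

/-- The data of an isometry `S`, a projection `P` orthogonal to the range of `S`, and the
operator `S (1 + (q - 1) P) + p P`. -/
structure ShiftData (S P : H →L[ℂ] H) : Prop where
  isometry : star S * S = 1
  star_proj : star P = P
  proj_mul_proj : P * P = P
  star_mul_proj : star S * P = 0

/-- The perturbation `S (1 - P + q P) + p P` of `S`. -/
noncomputable def perturb (S P : H →L[ℂ] H) (p q : ℂ) : H →L[ℂ] H :=
  S * (1 - P + q • P) + p • P

namespace ShiftData

variable {S P : H →L[ℂ] H} (h : ShiftData S P)
include h

theorem proj_mul : P * S = 0 := by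
  have := congrArg star h.star_mul_proj
  simpa [h.star_proj] using this

theorem proj_mul_perturb (p q : ℂ) : P * perturb S P p q = p • P := by
  simp [perturb, mul_add, ← mul_assoc, h.proj_mul, h.proj_mul_proj]

theorem star_perturb (p q : ℂ) :
    star (perturb S P p q) = (1 - P + conj q • P) * star S + conj p • P := by
  simp [perturb, h.star_proj]

theorem compl_mul (s t : ℂ) : (1 - P + s • P) * (1 - P + t • P) = 1 - P + (s * t) • P := by
  simp only [mul_add, add_mul, mul_sub, sub_mul, one_mul, mul_one, smul_mul_assoc,
    mul_smul_comm, h.proj_mul_proj]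
  module

theorem star_mul_self (p q : ℂ) :
    star (perturb S P p q) * perturb S P p q = 1 - P + (conj q * q + conj p * p) • P := by
  rw [h.star_perturb, add_mul, smul_mul_assoc, h.proj_mul_perturb, perturb, mul_add]
  have h1 : (1 - P + conj q • P) * star S * (S * (1 - P + q • P)) =
      1 - P + (conj q * q) • P := by
    rw [mul_assoc, ← mul_assoc (star S), h.isometry, one_mul, h.compl_mul]
  rw [h1, mul_smul_comm, mul_assoc, h.star_mul_proj, mul_zero, smul_zero, add_zero, smul_smul,
    add_assoc, add_smul]

omit h [CompleteSpace H] in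
theorem compl_eq_one_iff (hP : P ≠ 0) (s : ℂ) : 1 - P + s • P = 1 ↔ s = 1 := by
  constructor
  · intro h1
    have h2 : (s - 1) • P = 0 := by
      have : (s - 1) • P = (1 - P + s • P) - 1 := by rw [sub_smul, one_smul]; abel
      rw [this, h1, sub_self]
    exact sub_eq_zero.mp ((smul_eq_zero.mp h2).resolve_right hP)
  · rintro rfl
    simp

/-- `T*T - 1` is a multiple of `P`, and `T*PT = |p|²P = P`; hence `T*(T*T - 1)T = T*T - 1`. -/
theorem isTwoIsometry {p : ℂ} (hp : ‖p‖ = 1) (q : ℂ) : IsTwoIsometry (perturb S P p q) := by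
  have hpp : conj p * p = 1 := by
    rw [RCLike.conj_mul, hp]; simp
  rw [IsTwoIsometry, ← ContinuousLinearMap.star_eq_adjoint, pow_two, pow_two]
  have h1 := h.star_mul_self p q
  have h2 : star (perturb S P p q) * P * perturb S P p q = P := by
    have := congrArg star (h.proj_mul_perturb p q)
    simp only [star_mul, star_smul, h.star_proj] at this
    rw [this, smul_mul_assoc, h.proj_mul_perturb, smul_smul]
    simp [hpp]
  rw [hpp] at h1
  set T := perturb S P p q
  have h3 : star T * star T * (T * T) = 1 - P + (conj q * q + 1) • P + (conj q * q) • P := by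
    have h4 : star T * star T * (T * T) = star T * (star T * T) * T := by simp only [mul_assoc]
    have h5 : 1 - P + (conj q * q + 1) • P = 1 + (conj q * q) • P := by
      rw [add_smul, one_smul]; abel
    rw [h4, h1, h5, mul_add, add_mul, mul_one, h1, mul_smul_comm, smul_mul_assoc, h2, h5]
  rw [h3, h1]
  module

theorem inverse_star_mul_self {p q s : ℂ} (hs : (conj q * q + conj p * p) * s = 1) :
    IsUnit (star (perturb S P p q) * perturb S P p q) ∧
      Ring.inverse (star (perturb S P p q) * perturb S P p q) = 1 - P + s • P := by
  let U : (H →L[ℂ] H)ˣ :=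
    ⟨star (perturb S P p q) * perturb S P p q, 1 - P + s • P,
      by rw [h.star_mul_self, h.compl_mul, hs]; simp,
      by rw [h.star_mul_self, h.compl_mul, mul_comm, hs]; simp⟩
  exact ⟨U.isUnit, Ring.inverse_unit U⟩

theorem isLeftInvertible {p q s : ℂ} (hs : (conj q * q + conj p * p) * s = 1) :
    IsLeftInvertible (perturb S P p q) :=
  ⟨Ring.inverse (star (perturb S P p q) * perturb S P p q) * star (perturb S P p q), by
    rw [mul_assoc, Ring.inverse_mul_cancel _ (h.inverse_star_mul_self hs).1]⟩

theorem cauchyDual_perturb {p q s : ℂ} (hs : (conj q * q + conj p * p) * s = 1) :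
    cauchyDual (perturb S P p q) = perturb S P (p * s) (q * s) := by
  rw [cauchyDual, ← ContinuousLinearMap.star_eq_adjoint, (h.inverse_star_mul_self hs).2]
  conv_lhs => rw [perturb, add_mul, mul_assoc, h.compl_mul]
  rw [perturb]
  congr 1
  simp [mul_add, mul_sub, h.proj_mul_proj, smul_smul, mul_comm]

theorem isometry_perturb_iff (hP : P ≠ 0) (p q : ℂ) :
    Isometry (perturb S P p q) ↔ conj q * q + conj p * p = 1 := by
  rw [ContinuousLinearMap.isometry_iff_adjoint_comp_self, ← ContinuousLinearMap.star_eq_adjoint,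
    ← ContinuousLinearMap.mul_def, h.star_mul_self, compl_eq_one_iff hP]

/-- A Neumann series: `Y = (1 - αS)⁻¹ αβP`. Applying `S*` to the fixed-point equation gives `S*Y =
αY`. -/
theorem exists_eigenoperator {α β : ℂ} (hα : ‖α‖ < 1) :
    ∃ Y : H →L[ℂ] H, Y = (α * β) • P + α • (S * Y) ∧ Y * P = Y := by
  have hS : ‖S‖ ≤ 1 := by
    refine S.opNorm_le_bound zero_le_one fun x => ?_
    rw [(ContinuousLinearMap.norm_map_iff_adjoint_comp_self S).mpr h.isometry x, one_mul]
  have hlt : ‖α • S‖ < 1 := by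
    rw [norm_smul]
    exact (mul_le_of_le_one_right (norm_nonneg _) hS).trans_lt hα
  have hinv := Ring.mul_inverse_cancel _ (isUnit_one_sub_of_norm_lt_one hlt)
  refine ⟨Ring.inverse (1 - α • S) * ((α * β) • P), ?_, ?_⟩
  · have h1 := congrArg (fun B : H →L[ℂ] H => B * ((α * β) • P)) hinv
    simp only [sub_mul, one_mul, smul_mul_assoc, mul_assoc] at h1
    exact sub_eq_iff_eq_add.mp h1
  · rw [mul_assoc, smul_mul_assoc, h.proj_mul_proj]

theorem star_mul_self_eigenoperator {α β : ℂ} {Y : H →L[ℂ] H} {γ : ℝ}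
    (hα : ‖α‖ < 1) (hγ : ‖α‖ ^ 2 * ‖β‖ ^ 2 = γ * (1 - ‖α‖ ^ 2))
    (hY : Y = (α * β) • P + α • (S * Y)) : star Y * Y = (γ : ℂ) • P := by
  -- Expanding both copies of `Y` by the fixed-point equation, the cross terms vanish by `S*P = 0 =
  -- PS`; the resulting linear equation is solved for `Y*Y`.
  have h1 : star Y * Y = ((‖α‖ ^ 2 * ‖β‖ ^ 2 : ℝ) : ℂ) • P + ((‖α‖ ^ 2 : ℝ) : ℂ) • (star Y * Y) := by
    have hSY (x : H →L[ℂ] H) : star S * (S * x) = x := by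
      rw [← mul_assoc, h.isometry, one_mul]
    have hPS (x : H →L[ℂ] H) : P * (S * x) = 0 := by rw [← mul_assoc, h.proj_mul, zero_mul]
    conv_lhs => rw [hY]
    simp only [star_add, star_smul, star_mul, h.star_proj, add_mul, mul_add, smul_mul_assoc,
      mul_smul_comm, mul_assoc, hSY, hPS, h.star_mul_proj, h.proj_mul_proj, mul_zero, smul_zero,
      add_zero, zero_add, smul_smul]
    congr 2
    · push_cast
      rw [← Complex.mul_conj', ← Complex.mul_conj', RCLike.star_def]
      ring
    · push_cast
      rw [← Complex.mul_conj', RCLike.star_def]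
  have hne : ((1 - ‖α‖ ^ 2 : ℝ) : ℂ) ≠ 0 := by
    have : ‖α‖ ^ 2 < 1 := by nlinarith [norm_nonneg α]
    exact_mod_cast (sub_pos.mpr this).ne'
  have h2 : ((1 - ‖α‖ ^ 2 : ℝ) : ℂ) • (star Y * Y) = ((1 - ‖α‖ ^ 2 : ℝ) : ℂ) • ((γ : ℂ) • P) := by
    rw [smul_smul, ← Complex.ofReal_mul, mul_comm _ γ, ← hγ]
    conv_lhs => rw [Complex.ofReal_sub, sub_smul, Complex.ofReal_one, one_smul]
    exact sub_eq_iff_eq_add.mpr h1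
  exact (smul_right_injective _ hne) h2

end ShiftData

theorem shiftData_rankOne {S : H →L[ℂ] H} {e : H} (hS : star S * S = 1) (he : ‖e‖ = 1)
    (hSe : star S e = 0) : ShiftData S (rankOne ℂ e e) where
  isometry := hS
  star_proj := by rw [ContinuousLinearMap.star_eq_adjoint, adjoint_rankOne]
  proj_mul_proj := isIdempotentElem_rankOne_self he
  star_mul_proj := by rw [ContinuousLinearMap.mul_def, comp_rankOne, hSe]; simp

theorem isSubnormal_perturb_of_operator {S Y : H →L[ℂ] H} {e : H} (hS : star S * S = 1)
    (he : ‖e‖ = 1) (hSe : star S e = 0) {α β : ℂ} {γ : ℝ}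
    (hY : Y = (α * β) • rankOne ℂ e e + α • (S * Y)) (hYP : Y * rankOne ℂ e e = Y)
    (hYY : star Y * Y = (γ : ℂ) • rankOne ℂ e e) (hγ : ‖β‖ ^ 2 + γ ≤ 1) :
    IsSubnormal (perturb S (rankOne ℂ e e) α β) := by
  have h := shiftData_rankOne hS he hSe
  set P := rankOne ℂ e e with hPdef
  have hPf (f : H) : P f = inner ℂ e f • e := rfl
  have hSY : star S * Y = α • Y := by
    conv_lhs => rw [hY]
    rw [mul_add, mul_smul_comm, h.star_mul_proj, smul_zero, zero_add, mul_smul_comm, ← mul_assoc,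
      hS, one_mul]
  have hPT := h.proj_mul_perturb α β
  -- `A*A` and `Y*Y` together give `1 - P + (|β|² + γ)P`; the weight of `l` supplies the missing
  -- multiple of `P`. The eigenvalue of `l` is `α` because `PT = αP`.
  refine IsSubnormal.of_intertwining (S := S) (A := 1 - P + β • P) (Y := Y) (α := α)
    (l := (√(1 - ‖β‖ ^ 2 - γ) : ℂ) • innerSL ℂ e) hS ?_ ?_ ?_ ?_
  · have h1 : (1 - S * star S) * Y = (α * β) • P := by
      rw [sub_mul, one_mul, mul_assoc, hSY, mul_smul_comm]
      exact sub_eq_iff_eq_add.mpr hY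
    have h2 : (1 - P + β • P) * perturb S P α β = perturb S P α β - α • P + (α * β) • P := by
      rw [add_mul, sub_mul, one_mul, smul_mul_assoc, hPT, smul_smul, mul_comm β]
    rw [h1, h2, perturb, add_sub_cancel_right]
  · rw [hSY, ← hYP, mul_assoc, hPT, mul_smul_comm]
  · intro f
    have h1 : inner ℂ e (P (perturb S P α β f)) = inner ℂ e ((α • P) f) := by rw [← hPT]; rfl
    simp only [smul_apply, hPf, inner_smul_right, inner_self_eq_norm_sq_to_K,
      he] at h1
    simp only [smul_apply, innerSL_apply_apply, smul_eq_mul]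
    simp only [Complex.coe_algebraMap, Complex.ofReal_one, one_pow, mul_one] at h1
    rw [h1]
    ring
  · intro f
    have key (B : H →L[ℂ] H) : ‖B f‖ ^ 2 = (inner ℂ f ((star B * B) f)).re :=
      B.apply_norm_sq_eq_inner_adjoint_right f
    have hA : star (1 - P + β • P) * (1 - P + β • P) = 1 - P + ((‖β‖ ^ 2 : ℝ) : ℂ) • P := by
      have : star (1 - P + β • P) = 1 - P + conj β • P := by simp [h.star_proj]
      rw [this, h.compl_mul, RCLike.conj_mul]
      simp
    have hfe : (inner ℂ f (P f)).re = ‖(inner ℂ e f : ℂ)‖ ^ 2 := by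
      rw [hPf, inner_smul_right, ← inner_conj_symm f e, Complex.mul_conj, Complex.ofReal_re,
        Complex.normSq_eq_norm_sq]
    rw [key, key, hA, hYY]
    simp only [smul_apply, innerSL_apply_apply, smul_eq_mul, norm_mul, mul_pow,
      add_apply, sub_apply, one_apply_eq_self,
      inner_add_right, inner_sub_right, inner_smul_right, Complex.add_re, Complex.sub_re,
      Complex.re_ofReal_mul, hfe, Complex.norm_real, Real.norm_eq_abs, sq_abs]
    rw [Real.sq_sqrt (by linarith)]
    have : (inner ℂ f f : ℂ).re = ‖f‖ ^ 2 := inner_self_eq_norm_sq (𝕜 := ℂ) f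
    rw [this]
    ring

/-- Among the perturbations `S (1 - P + β P) + α P`, those whose coefficients are such that
`β = 0` (and `|α|` is arbitrary), or `|α| < 1` and `|α|² + |β|² ≤ 1`, are subnormal. -/
theorem isSubnormal_perturb {S : H →L[ℂ] H} {e : H} (hS : star S * S = 1)
    (he : ‖e‖ = 1) (hSe : star S e = 0) {α β : ℂ}
    (hαβ : β = 0 ∨ ‖α‖ < 1 ∧ ‖α‖ ^ 2 + ‖β‖ ^ 2 ≤ 1) :
    IsSubnormal (perturb S (rankOne ℂ e e) α β) := by
  obtain rfl | ⟨hα, hle⟩ := hαβ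
  -- With `|α| = 1` allowed, `1 - αS` need not be invertible, but `β = 0` makes `Y = 0` sufficient.
  · exact isSubnormal_perturb_of_operator (Y := 0) (γ := 0) hS he hSe
      (by simp) (by simp) (by simp) (by simp)
  · have h := shiftData_rankOne hS he hSe
    have hpos : 0 < 1 - ‖α‖ ^ 2 := by nlinarith [norm_nonneg α]
    obtain ⟨Y, hY, hYP⟩ := h.exists_eigenoperator (β := β) hα
    refine isSubnormal_perturb_of_operator (γ := ‖α‖ ^ 2 * ‖β‖ ^ 2 / (1 - ‖α‖ ^ 2)) hS he hSe hY hYP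
      (h.star_mul_self_eigenoperator hα (by field_simp) hY) ?_
    have : ‖β‖ ^ 2 + ‖α‖ ^ 2 * ‖β‖ ^ 2 / (1 - ‖α‖ ^ 2) = ‖β‖ ^ 2 / (1 - ‖α‖ ^ 2) := by
      field_simp; ring
    rw [this, div_le_one hpos]
    linarith

theorem perturb_properties {S : H →L[ℂ] H} {e : H} (hS : star S * S = 1)
    (he : ‖e‖ = 1) (hSe : star S e = 0) {p : ℂ} (hp : ‖p‖ = 1) (q : ℂ) :
    let T := perturb S (rankOne ℂ e e) p q
    IsTwoIsometry T ∧ IsLeftInvertible T ∧ IsSubnormal (cauchyDual T) ∧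
      (Isometry (cauchyDual T) ↔ Isometry T) ∧ (Isometry T ↔ q = 0) := by
  intro T
  have h := shiftData_rankOne hS he hSe
  have hP : rankOne ℂ e e ≠ 0 := by
    rw [← norm_ne_zero_iff]; simp [he]
  have hsum : conj q * q + conj p * p = ((‖q‖ ^ 2 + 1 : ℝ) : ℂ) := by
    rw [RCLike.conj_mul, RCLike.conj_mul, hp]; simp
  have hpos : 0 < ‖q‖ ^ 2 + 1 := by positivity
  have hs : (conj q * q + conj p * p) * (((‖q‖ ^ 2 + 1)⁻¹ : ℝ) : ℂ) = 1 := by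
    rw [hsum, ← Complex.ofReal_mul, mul_inv_cancel₀ hpos.ne', Complex.ofReal_one]
  have hT : Isometry T ↔ q = 0 := by
    rw [h.isometry_perturb_iff hP, hsum]
    norm_cast
    simp
  have hdual := h.cauchyDual_perturb hs
  have hnorm (z : ℂ) : ‖z * (((‖q‖ ^ 2 + 1)⁻¹ : ℝ) : ℂ)‖ = ‖z‖ / (‖q‖ ^ 2 + 1) := by
    rw [norm_mul, Complex.norm_real, Real.norm_of_nonneg (by positivity), div_eq_mul_inv]
  -- For the dual, `|α|² + |β|² = s`; this is at most `1`, with equality exactly when `q = 0`.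
  have hsq : (‖p‖ / (‖q‖ ^ 2 + 1)) ^ 2 + (‖q‖ / (‖q‖ ^ 2 + 1)) ^ 2 = (‖q‖ ^ 2 + 1)⁻¹ := by
    rw [hp]; field_simp; ring
  refine ⟨h.isTwoIsometry hp q, h.isLeftInvertible hs, ?_, ?_, hT⟩
  · rw [hdual]
    apply isSubnormal_perturb hS he hSe
    by_cases hq : q = 0
    · left; simp [hq]
    · right
      have hq' : 0 < ‖q‖ ^ 2 := by positivity
      rw [hnorm, hnorm, hsq, hp]
      exact ⟨(div_lt_one hpos).mpr (by linarith), inv_le_one_of_one_le₀ (by linarith)⟩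
  · rw [hT, hdual, h.isometry_perturb_iff hP, RCLike.conj_mul, RCLike.conj_mul, hnorm, hnorm,
      add_comm]
    have : (((‖p‖ / (‖q‖ ^ 2 + 1) : ℝ) : ℂ) ^ 2 + ((‖q‖ / (‖q‖ ^ 2 + 1) : ℝ) : ℂ) ^ 2 = 1) ↔
        (‖q‖ ^ 2 + 1)⁻¹ = 1 := by
      rw [← hsq]; norm_cast
    refine Iff.trans this ?_
    simp

end RankOnePerturbation

/-! ### The concrete isometric shift on `ℓ²`. -/

section Shift

theorem L2Nat.ext {f g : L2Nat} (h : ∀ n, f n = g n) : f = g :=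
  Lp.ext (Filter.Eventually.of_forall h)

theorem eq_of_ae_eq_count {f g : ℕ → ℂ} (h : f =ᵐ[Measure.count] g) (n : ℕ) : f n = g n := by
  by_contra hn
  have h0 : Measure.count {n | ¬ f n = g n} = 0 := h
  rw [Measure.count_eq_zero_iff] at h0
  exact (Set.eq_empty_iff_forall_notMem.mp h0 n) hn

theorem C_apply (w : ℕ → ℂ) (f : (C w).domain) (n : ℕ) : C w f n = w n * f.1 (phi n) :=
  eq_of_ae_eq_count (MemLp.coeFn_toLp f.2) n

theorem mem_domain_C_of_forall {w : ℕ → ℂ} {f g : L2Nat} (h : ∀ n, g n = w n * f (phi n)) :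
    f ∈ (C w).domain :=
  (Lp.memLp g).ae_eq (Filter.Eventually.of_forall h)

/-- `v 0 = 0` kills the term at the fixed point of `phi`; the remaining terms reindex the full sum.
-/
theorem eLpNorm_shift {v : ℕ → ℂ} (hv0 : v 0 = 0) (hv : ∀ n, ‖v (n + 1)‖ = 1) (f : ℕ → ℂ) :
    eLpNorm (fun n => v n * f (phi n)) 2 Measure.count = eLpNorm f 2 Measure.count := by
  have hv' (n : ℕ) : ‖v (n + 1)‖ₑ = 1 := by rw [← ofReal_norm, hv, ENNReal.ofReal_one]
  rw [eLpNorm_eq_lintegral_rpow_enorm_toReal two_ne_zero ENNReal.ofNat_ne_top,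
    eLpNorm_eq_lintegral_rpow_enorm_toReal two_ne_zero ENNReal.ofNat_ne_top,
    lintegral_count, lintegral_count, tsum_eq_zero_add' ENNReal.summable]
  simp [hv0, hv', phi, enorm_mul]

theorem mem_domain_shift {v : ℕ → ℂ} (hv0 : v 0 = 0) (hv : ∀ n, ‖v (n + 1)‖ = 1) (f : L2Nat) :
    f ∈ (C v).domain :=
  ⟨(measurable_from_top (f := fun n => v n * f (phi n))).aestronglyMeasurable, by
    rw [eLpNorm_shift hv0 hv]; exact Lp.eLpNorm_lt_top f⟩

/-- The weighted shift with unimodular weights `v 1, v 2, …` as an isometry. -/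
noncomputable def shiftIsometry (v : ℕ → ℂ) (hv0 : v 0 = 0) (hv : ∀ n, ‖v (n + 1)‖ = 1) :
    L2Nat →ₗᵢ[ℂ] L2Nat where
  toLinearMap := (C v).toFun ∘ₗ
    LinearMap.codRestrict (C v).domain LinearMap.id (mem_domain_shift hv0 hv)
  norm_map' f := by
    refine (Lp.norm_toLp (fun n => v n * f (phi n)) (mem_domain_shift hv0 hv f)).trans ?_
    rw [Lp.norm_def]
    exact congrArg ENNReal.toReal (eLpNorm_shift hv0 hv f)

theorem shiftIsometry_apply {v : ℕ → ℂ} (hv0 : v 0 = 0) (hv : ∀ n, ‖v (n + 1)‖ = 1) (f : L2Nat)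
    (n : ℕ) : shiftIsometry v hv0 hv f n = v n * f (phi n) :=
  C_apply v _ n

/-- The unit vector supported at `0`. -/
noncomputable def unitZero : L2Nat :=
  indicatorConstLp 2 (measurableSet_singleton (0 : ℕ)) (by simp) 1

theorem unitZero_apply (n : ℕ) : unitZero n = if n = 0 then 1 else 0 := by
  have := eq_of_ae_eq_count (indicatorConstLp_coeFn (p := 2) (c := (1 : ℂ))
    (hs := measurableSet_singleton (0 : ℕ)) (hμs := by simp)) n
  rw [unitZero, this]
  simp [Set.indicator_apply]

theorem norm_unitZero : ‖unitZero‖ = 1 := by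
  rw [unitZero, norm_indicatorConstLp two_ne_zero ENNReal.ofNat_ne_top]
  simp [Measure.real]

theorem inner_unitZero (f : L2Nat) : inner ℂ unitZero f = f 0 := by
  rw [unitZero, L2.inner_indicatorConstLp_one, Measure.restrict_singleton]
  simp

end Shift

end CauchyDual

theorem mainTheorem5 (w : ℕ → ℂ) (h0 : ‖w 0‖ = 1) (hw : ∀ n : ℕ, 2 ≤ n → ‖w n‖ = 1) :
    ∃ T : CauchyDual.L2Nat →L[ℂ] CauchyDual.L2Nat,
      -- `C_{φ,w}` is everywhere defined and equals the bounded operator `T`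
      CauchyDual.C w = (T : CauchyDual.L2Nat →ₗ[ℂ] CauchyDual.L2Nat).toPMap ⊤ ∧
      CauchyDual.IsTwoIsometry T ∧
      -- so the Cauchy dual is meaningful
      CauchyDual.IsLeftInvertible T ∧
      CauchyDual.IsSubnormal (CauchyDual.cauchyDual T) ∧
      (Isometry (CauchyDual.cauchyDual T) ↔ Isometry T) ∧
      (Isometry T ↔ w 1 = 0) := by
  open CauchyDual in
  -- Weight `0` at `0` puts the range of `S` orthogonal to `unitZero`; weight `1` at `1` stands in
  -- for the arbitrary `w 1`, which enters through the perturbation.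
  let v : ℕ → ℂ
    | 0 => 0
    | 1 => 1
    | n + 2 => w (n + 2)
  have hv (n : ℕ) : ‖v (n + 1)‖ = 1 := by
    cases n with
    | zero => exact norm_one
    | succ n => exact hw (n + 2) (by omega)
  let S := shiftIsometry v rfl hv
  have hSapp (f : L2Nat) (n : ℕ) : S f n = v n * f (phi n) := shiftIsometry_apply rfl hv f n
  have hS : star S.toContinuousLinearMap * S.toContinuousLinearMap = 1 :=
    S.toContinuousLinearMap.isometry_iff_adjoint_comp_self.mp S.isometry
  have hSe : star S.toContinuousLinearMap unitZero = 0 := by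
    refine ext_inner_right ℂ fun f => ?_
    rw [ContinuousLinearMap.star_eq_adjoint, ContinuousLinearMap.adjoint_inner_left,
      inner_unitZero, inner_zero_left]
    exact (hSapp f 0).trans (zero_mul _)
  let T := perturb S.toContinuousLinearMap (InnerProductSpace.rankOne ℂ unitZero unitZero)
    (w 0) (w 1)
  have hTapp (f : L2Nat) (n : ℕ) : T f n = w n * f (phi n) := by
    have hT : T f = S (f - f 0 • unitZero + w 1 • f 0 • unitZero) + w 0 • f 0 • unitZero := by
      simp [T, perturb, inner_unitZero]
    have hadd (f g : L2Nat) (n : ℕ) : (f + g : L2Nat) n = f n + g n :=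
      eq_of_ae_eq_count (Lp.coeFn_add f g) n
    have hsub (f g : L2Nat) (n : ℕ) : (f - g : L2Nat) n = f n - g n :=
      eq_of_ae_eq_count (Lp.coeFn_sub f g) n
    have hsmul (c : ℂ) (f : L2Nat) (n : ℕ) : (c • f : L2Nat) n = c * f n :=
      eq_of_ae_eq_count (Lp.coeFn_smul c f) n
    simp only [hT, hadd, hSapp, hsub, hsmul, unitZero_apply]
    match n with
    | 0 => simp [v, phi]
    | 1 => simp [v, phi]
    | n + 2 => simp [v, phi]
  refine ⟨T, LinearPMap.ext ?_ fun f hf _ => ?_,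
    perturb_properties hS norm_unitZero hSe h0 (w 1)⟩
  · exact eq_top_iff.mpr fun f _ => mem_domain_C_of_forall (hTapp f)
  · refine L2Nat.ext fun n => ?_
    rw [C_apply]
    exact (hTapp f n).symm
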